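/- Let $n,k\ge 1$ be integers and let $A=(A_{ij})_{i,j=1}^n$ be a (Hermitian) positive definite $nk\times nk$ complex matrix, partitioned into $n\times n$ blocks $A_{ij}\in\mathbb{C}^{k\times k}$. Let $\tau$ be a derangement of $\{1,\dots,n\}$, that is, a permutation with $\tau(i)\neq i$ for all $i$. Then $$\det A+\prod_{i=1}^{n}\bigl|\det A_{i,\tau(i)}\bigr|\le\prod_{i=1}^{n}\det A_{ii}.$$ Moreover, if $(n,k)\neq(2,1)$, then equality holds if and only if $A$ is block diagonal, that is, $A_{ij}=0$ for all $i\ne j$. -/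

import Mathlib

open scoped ComplexOrder

/-!
For blocks `a ≠ b` write `d a = det (A a a)` and `q a b = |det (A a b)|² / (d a * d b)`
(`Matrix.relDet`). The proof compares both summands with a single number `q a b`.

*Bound on `det A`.* Fischer's inequality (`Matrix.PosDef.det_re_le_mul`), applied with the blocks
`a` and `b` kept together, bounds `det A` by the determinant `m` of the principal submatrix on
these two blocks times the remaining `d i`. The Schur complement `R` of `A a a` in that submatrix and
the matrix `S = (A a b)ᴴ * (A a a)⁻¹ * A a b` satisfy `R + S = A b b`; if `t i` denote the
eigenvalues of `S` relative to `R`, then `d a * d b = m * ∏ (1 + t i)` and `|det (A a b)|² = m * ∏ t i`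
(`Matrix.PosDef.exists_two_block`). From `1 + ∏ t i ≤ ∏ (1 + t i)` it follows that
`det A ≤ (1 - q a b) * ∏ d i`, and also that `q a b < 1`.

*Bound on the product over `τ`.* As `τ` is a permutation, the square of `∏ |det (A i (τ i))|` is
`(∏ d i)² * ∏ q i (τ i)`. Choose `a` with `q a (τ a)` maximal. As `τ a ≠ a`, the product
`∏ q i (τ i)` has at least two factors, all in `[0, 1)`, so it is at most `(q a (τ a))²`, and
`∏ |det (A i (τ i))| ≤ q a (τ a) * ∏ d i`. Adding the two bounds with `b = τ a` gives the
inequality.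

*Equality.* If `q a (τ a) > 0`, one of the two bounds is strict: the first one when the blocks have
size at least two, because then `1 + ∏ t i < ∏ (1 + t i)` for positive `t i`; the second one when
there are at least three blocks, because of a third factor smaller than `1`. If `q a (τ a) = 0`,
equality says `det A = ∏ d i`, so that for every pair `a ≠ b` the corresponding `t` vanishes, and
with it `A a b`.

A partitioned matrix is treated as a matrix `M` indexed by `κ × ι`; its block `(a, b)` is
`M.submatrix (Prod.mk a) (Prod.mk b)`. Determinants of positive definite matrices are handled
through their real parts.
-/

/-! ### Inequalities between products of reals -/

theorem one_le_prod_one_add {ι : Type*} (s : Finset ι) {t : ι → ℝ} (ht : 0 ≤ t) :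
    1 ≤ ∏ i ∈ s, (1 + t i) := by
  simpa using Finset.prod_le_prod (s := s) (f := fun _ => (1 : ℝ)) (fun _ _ => zero_le_one)
    fun i _ => le_add_of_nonneg_right (ht i)

theorem prod_le_prod_one_add {ι : Type*} (s : Finset ι) {t : ι → ℝ} (ht : 0 ≤ t) :
    ∏ i ∈ s, t i ≤ ∏ i ∈ s, (1 + t i) :=
  Finset.prod_le_prod (fun i _ => ht i) fun _ _ => le_add_of_nonneg_left zero_le_one

theorem one_add_prod_le_prod_one_add {ι : Type*} [Fintype ι] [Nonempty ι] {t : ι → ℝ}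
    (ht : 0 ≤ t) : 1 + ∏ i, t i ≤ ∏ i, (1 + t i) := by
  classical
  let a := Classical.arbitrary ι
  rw [← Finset.mul_prod_erase _ t (Finset.mem_univ a),
    ← Finset.mul_prod_erase _ (fun i => 1 + t i) (Finset.mem_univ a), one_add_mul]
  exact add_le_add (one_le_prod_one_add _ ht)
    (mul_le_mul_of_nonneg_left (prod_le_prod_one_add _ ht) (ht a))

theorem one_add_prod_lt_prod_one_add {ι : Type*} [Fintype ι] [Nontrivial ι] {t : ι → ℝ}
    (ht : ∀ i, 0 < t i) : 1 + ∏ i, t i < ∏ i, (1 + t i) := by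
  classical
  have ht' : 0 ≤ t := fun i => (ht i).le
  obtain ⟨a, b, hab⟩ := exists_pair_ne ι
  rw [← Finset.mul_prod_erase _ t (Finset.mem_univ a),
    ← Finset.mul_prod_erase _ (fun i => 1 + t i) (Finset.mem_univ a), one_add_mul]
  refine add_lt_add_of_lt_of_le ?_
    (mul_le_mul_of_nonneg_left (prod_le_prod_one_add _ ht') (ht a).le)
  have hb : b ∈ Finset.univ.erase a := by simp [hab.symm]
  rw [← Finset.mul_prod_erase _ (fun i => 1 + t i) hb]
  have := one_le_prod_one_add ((Finset.univ.erase a).erase b) ht'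
  nlinarith [ht b]

theorem eq_zero_of_prod_one_add_eq_one {ι : Type*} [Fintype ι] {t : ι → ℝ}
    (ht : 0 ≤ t) (h : ∏ i, (1 + t i) = 1) : t = 0 := by
  classical
  ext a
  rw [← Finset.mul_prod_erase _ (fun i => 1 + t i) (Finset.mem_univ a)] at h
  have := one_le_prod_one_add (Finset.univ.erase a) ht
  have ha : 0 ≤ t a := ht a
  exact le_antisymm (by change t a ≤ 0; nlinarith) ha

/-- If all factors lie in `[0, 1]`, the product of any two of them, and hence of all, is at most the
square of the largest one. -/
theorem prod_le_sq_of_forall_le {κ : Type*} [Fintype κ] [DecidableEq κ] {q : κ → ℝ}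
    (h0 : ∀ i, 0 ≤ q i) (h1 : ∀ i, q i ≤ 1) {a b : κ} (hab : a ≠ b) (hmax : ∀ i, q i ≤ q a) :
    ∏ i, q i ≤ q a ^ 2 := by
  have hb : b ∈ Finset.univ.erase a := by simp [hab.symm]
  rw [← Finset.mul_prod_erase _ q (Finset.mem_univ a), ← Finset.mul_prod_erase _ q hb, sq]
  refine mul_le_mul_of_nonneg_left ?_ (h0 a)
  exact (mul_le_of_le_one_right (h0 b)
    (Finset.prod_le_one (fun i _ => h0 i) fun i _ => h1 i)).trans (hmax b)

/-- With a third factor, the bound by the square of the largest one is strict. -/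
theorem prod_lt_sq_of_forall_le {κ : Type*} [Fintype κ] [DecidableEq κ] {q : κ → ℝ}
    (h0 : ∀ i, 0 ≤ q i) (h1 : ∀ i, q i < 1) {a b c : κ} (hab : a ≠ b) (hac : a ≠ c) (hbc : b ≠ c)
    (hmax : ∀ i, q i ≤ q a) (ha : 0 < q a) : ∏ i, q i < q a ^ 2 := by
  have hb : b ∈ Finset.univ.erase a := by simp [hab.symm]
  have hc : c ∈ (Finset.univ.erase a).erase b := by simp [hac.symm, hbc.symm]
  rw [← Finset.mul_prod_erase _ q (Finset.mem_univ a), ← Finset.mul_prod_erase _ q hb,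
    ← Finset.mul_prod_erase _ q hc, sq]
  refine mul_lt_mul_of_pos_left ?_ ha
  have hP := Finset.prod_le_one (s := ((Finset.univ.erase a).erase b).erase c)
    (fun i _ => h0 i) fun i _ => (h1 i).le
  have hcP : q c * ∏ i ∈ ((Finset.univ.erase a).erase b).erase c, q i < 1 :=
    (mul_le_of_le_one_right (h0 c) hP).trans_lt (h1 c)
  rcases (h0 b).eq_or_lt with h | h
  · simpa [← h] using ha
  · exact (mul_lt_of_lt_one_right h hcP).trans_le (hmax b)

namespace Matrix

/-! ### Determinants of positive definite matrices -/

theorem PosDef.ofReal_det_re {α : Type*} [Fintype α] [DecidableEq α] {M : Matrix α α ℂ}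
    (hM : M.PosDef) : ((M.det.re : ℝ) : ℂ) = M.det :=
  (Complex.eq_re_of_ofReal_le (r := 0) (by simpa using hM.det_pos.le)).symm

theorem PosDef.det_re_pos {α : Type*} [Fintype α] [DecidableEq α] {M : Matrix α α ℂ}
    (hM : M.PosDef) : 0 < M.det.re :=
  (Complex.lt_def.mp hM.det_pos).1

theorem IsHermitian.det_one_add {ι : Type*} [Fintype ι] [DecidableEq ι] {T : Matrix ι ι ℂ}
    (hT : T.IsHermitian) : (1 + T).det = ((∏ i, (1 + hT.eigenvalues i) : ℝ) : ℂ) := by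
  have h : 1 + T = Unitary.conjStarAlgAut ℂ _ hT.eigenvectorUnitary
      (1 + diagonal (RCLike.ofReal ∘ hT.eigenvalues)) := by
    rw [map_add, map_one, ← hT.spectral_theorem]
  rw [h, Unitary.conjStarAlgAut_apply, det_mul_right_comm,
    Unitary.mul_star_self_of_mem hT.eigenvectorUnitary.2, one_mul,
    ← diagonal_one, diagonal_add, det_diagonal]
  push_cast
  rfl

/-- Simultaneous diagonalisation of a positive definite `R` and a positive semidefinite `S`, read
off on determinants: the `t i` are the eigenvalues of `S` relative to `R`. -/
theorem PosDef.exists_relative_eigenvalues {ι : Type*} [Fintype ι] [DecidableEq ι]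
    {R S : Matrix ι ι ℂ} (hR : R.PosDef) (hS : S.PosSemidef) :
    ∃ t : ι → ℝ, 0 ≤ t ∧ S.det = R.det * ((∏ i, t i : ℝ) : ℂ) ∧
      (R + S).det = R.det * ((∏ i, (1 + t i) : ℝ) : ℂ) ∧ (t = 0 → S = 0) := by
  obtain ⟨C, hC⟩ : ∃ C : Matrix ι ι ℂ, R = Cᴴ * C := by
    open scoped MatrixOrder in
    exact CStarAlgebra.nonneg_iff_eq_star_mul_self.mp hR.posSemidef.nonneg
  have hCu : IsUnit C.det := by
    rw [isUnit_iff_ne_zero]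
    intro h
    have := hR.det_pos.ne'
    simp [hC, h] at this
  have hCu' : IsUnit Cᴴ.det := by simpa [det_conjTranspose] using hCu
  have hT : ((C⁻¹)ᴴ * S * C⁻¹).PosSemidef := hS.conjTranspose_mul_mul_same _
  -- `R = Cᴴ * C` is congruent to the identity; `T` is the image of `S` under the same congruence
  have hST : S = Cᴴ * ((C⁻¹)ᴴ * S * C⁻¹) * C := by
    rw [conjTranspose_nonsing_inv]
    simp only [Matrix.mul_assoc]
    rw [nonsing_inv_mul _ hCu, mul_one, ← Matrix.mul_assoc, mul_nonsing_inv _ hCu', one_mul]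
  generalize (C⁻¹)ᴴ * S * C⁻¹ = T at hT hST
  have hdet : R.det = Cᴴ.det * C.det := by rw [hC, det_mul]
  refine ⟨hT.isHermitian.eigenvalues, fun i => hT.eigenvalues_nonneg i, ?_, ?_, ?_⟩
  · rw [hdet, hST, det_mul, det_mul, hT.isHermitian.det_eq_prod_eigenvalues]
    push_cast
    simp only [Complex.coe_algebraMap]
    ring
  · have : R + S = Cᴴ * (1 + T) * C := by
      rw [hC, hST, Matrix.mul_add, Matrix.add_mul, mul_one]
    rw [this, hdet, det_mul, det_mul, IsHermitian.det_one_add hT.isHermitian]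
    ring
  · intro h
    rw [hST, hT.isHermitian.eigenvalues_eq_zero_iff.mp h, mul_zero, zero_mul]

/-- The Schur complement `R = Q - Xᴴ * P⁻¹ * X` of the corner `P` is positive definite: it is
positive semidefinite, and its determinant is that of the whole matrix divided by `det P`. -/
theorem PosDef.exists_schur {α β : Type*} [Fintype α] [Fintype β] [DecidableEq α] [DecidableEq β]
    {P : Matrix α α ℂ} {X : Matrix α β ℂ} {Q : Matrix β β ℂ}
    (hM : (fromBlocks P X Xᴴ Q).PosDef) :
    ∃ R : Matrix β β ℂ, R.PosDef ∧ (Xᴴ * P⁻¹ * X).PosSemidef ∧ R + Xᴴ * P⁻¹ * X = Q ∧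
      (fromBlocks P X Xᴴ Q).det = P.det * R.det := by
  have hP : P.PosDef := hM.submatrix (e := Sum.inl) Sum.inl_injective
  have := hP.isUnit.invertible
  have hdet := det_fromBlocks₁₁ P X Xᴴ Q
  rw [invOf_eq_nonsing_inv] at hdet
  refine ⟨Q - Xᴴ * P⁻¹ * X, ?_, hP.inv.posSemidef.conjTranspose_mul_mul_same X,
    sub_add_cancel _ _, hdet⟩
  have hR := (PosDef.fromBlocks₁₁ X Q hP).mp hM.posSemidef
  rw [hR.posDef_iff_det_ne_zero]
  intro h
  rw [h, mul_zero] at hdet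
  exact hM.det_pos.ne' hdet

/-- Splitting the index type along `f` and `g` puts a positive definite matrix into `2 × 2` block
form. -/
theorem PosDef.fromBlocks_submatrix {α β γ : Type*} [Fintype α] [Fintype β] [Fintype γ]
    [DecidableEq α] [DecidableEq β] [DecidableEq γ] {M : Matrix γ γ ℂ} (hM : M.PosDef)
    {f : α → γ} {g : β → γ} (hfg : Function.Bijective (Sum.elim f g)) :
    (fromBlocks (M.submatrix f f) (M.submatrix f g) (M.submatrix f g)ᴴ
        (M.submatrix g g)).PosDef ∧
      M.det = (fromBlocks (M.submatrix f f) (M.submatrix f g) (M.submatrix f g)ᴴ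
        (M.submatrix g g)).det := by
  have hblk : M.submatrix (Sum.elim f g) (Sum.elim f g) =
      fromBlocks (M.submatrix f f) (M.submatrix f g) (M.submatrix f g)ᴴ (M.submatrix g g) := by
    rw [conjTranspose_submatrix, hM.isHermitian.eq]
    ext (i | i) (j | j) <;> rfl
  rw [← hblk]
  exact ⟨hM.submatrix hfg.injective, (det_submatrix_equiv_self (Equiv.ofBijective _ hfg) M).symm⟩

/-- **Fischer's inequality**: the determinant of a positive definite matrix is at most the product
of the determinants of two complementary principal submatrices, given here as the restrictions along
`f` and `g`, which jointly enumerate the index type. -/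
theorem PosDef.det_re_le_mul {α β γ : Type*} [Fintype α] [Fintype β] [Fintype γ]
    [DecidableEq α] [DecidableEq β] [DecidableEq γ] {M : Matrix γ γ ℂ} (hM : M.PosDef)
    {f : α → γ} {g : β → γ} (hfg : Function.Bijective (Sum.elim f g)) :
    M.det.re ≤ (M.submatrix f f).det.re * (M.submatrix g g).det.re := by
  obtain ⟨hN, hdet⟩ := PosDef.fromBlocks_submatrix hM hfg
  obtain ⟨R, hR, hS, hRS, hd⟩ := PosDef.exists_schur hN
  obtain ⟨t, ht, -, h2, -⟩ := PosDef.exists_relative_eigenvalues hR hS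
  have hf := hM.submatrix (e := f) fun x y h => Sum.inl_injective (hfg.injective (by simpa using h))
  rw [hdet, hd, ← hRS, h2, ← PosDef.ofReal_det_re hf, ← PosDef.ofReal_det_re hR]
  norm_cast
  refine mul_le_mul_of_nonneg_left ?_ (PosDef.det_re_pos hf).le
  refine le_mul_of_one_le_right (PosDef.det_re_pos hR).le ?_
  exact one_le_prod_one_add _ ht

/-- For a positive definite matrix with two blocks of the same size, the determinants of the
diagonal and the off-diagonal blocks are governed by one family `t`: the eigenvalues of `Xᴴ * P⁻¹ * X`
relative to the Schur complement of `P`, where `P` and `X` are the blocks of the first row. -/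
theorem PosDef.exists_two_block {ι γ : Type*} [Fintype ι] [Fintype γ]
    [DecidableEq ι] [DecidableEq γ] {M : Matrix γ γ ℂ} (hM : M.PosDef)
    {f g : ι → γ} (hfg : Function.Bijective (Sum.elim f g)) :
    ∃ t : ι → ℝ, 0 ≤ t ∧
      (M.submatrix f f).det.re * (M.submatrix g g).det.re = M.det.re * ∏ i, (1 + t i) ∧
      ‖(M.submatrix f g).det‖ ^ 2 = M.det.re * ∏ i, t i ∧ (t = 0 → M.submatrix f g = 0) := by
  obtain ⟨hN, hdet⟩ := PosDef.fromBlocks_submatrix hM hfg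
  obtain ⟨R, hR, hS, hRS, hd⟩ := PosDef.exists_schur hN
  obtain ⟨t, ht, h1, h2, h3⟩ := PosDef.exists_relative_eigenvalues hR hS
  have hf := hM.submatrix (e := f) fun x y h => Sum.inl_injective (hfg.injective (by simpa using h))
  refine ⟨t, ht, ?_, ?_, fun h => ?_⟩
  · rw [hdet, hd, ← hRS, h2, ← PosDef.ofReal_det_re hf, ← PosDef.ofReal_det_re hR]
    norm_cast
    ring
  · rw [det_mul, det_mul, det_nonsing_inv, det_conjTranspose, Ring.inverse_eq_inv'] at h1
    have hne : (M.submatrix f f).det ≠ 0 := hf.det_pos.ne'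
    have h4 : ((‖(M.submatrix f g).det‖ ^ 2 : ℝ) : ℂ) = M.det * ((∏ i, t i : ℝ) : ℂ) := by
      rw [hdet, hd, mul_assoc, ← h1]
      push_cast
      rw [← Complex.conj_mul']
      field_simp
      exact mul_comm _ _
    rw [← PosDef.ofReal_det_re hM] at h4
    exact_mod_cast h4
  · -- writing `P⁻¹ = Cᴴ * C`, the hypothesis `Xᴴ * P⁻¹ * X = 0` says `(C * X)ᴴ * (C * X) = 0`
    have hz := h3 h
    obtain ⟨C, hC⟩ : ∃ C : Matrix ι ι ℂ, (M.submatrix f f)⁻¹ = Cᴴ * C := by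
      open scoped MatrixOrder in
      exact CStarAlgebra.nonneg_iff_eq_star_mul_self.mp hf.inv.posSemidef.nonneg
    have hCX : C * M.submatrix f g = 0 := by
      rw [← conjTranspose_mul_self_eq_zero, conjTranspose_mul, ← hz, hC]
      simp only [Matrix.mul_assoc]
    have hPX : (M.submatrix f f)⁻¹ * M.submatrix f g = 0 := by
      rw [hC, Matrix.mul_assoc, hCX, Matrix.mul_zero]
    have := congrArg (M.submatrix f f * ·) hPX
    simpa [← Matrix.mul_assoc, mul_nonsing_inv _ hf.det_pos.ne'.isUnit] using this

/-! ### Partitioned matrices -/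

/-- The principal submatrix of a partitioned matrix on the blocks indexed by `s`. -/
def principalBlock {κ ι : Type*} (M : Matrix (κ × ι) (κ × ι) ℂ) (s : Finset κ) :
    Matrix (s × ι) (s × ι) ℂ :=
  M.submatrix (Prod.map Subtype.val id) (Prod.map Subtype.val id)

theorem PosDef.principalBlock_posDef {κ ι : Type*} {M : Matrix (κ × ι) (κ × ι) ℂ} (hM : M.PosDef)
    (s : Finset κ) : (principalBlock M s).PosDef :=
  hM.submatrix (Subtype.val_injective.prodMap Function.injective_id)

theorem det_principalBlock_univ {κ ι : Type*} [Fintype κ] [DecidableEq κ] [Fintype ι]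
    [DecidableEq ι] (M : Matrix (κ × ι) (κ × ι) ℂ) :
    (principalBlock M Finset.univ).det = M.det :=
  det_submatrix_equiv_self
    (Equiv.prodCongr (Equiv.subtypeUnivEquiv Finset.mem_univ) (Equiv.refl ι)) M

/-- Fischer's inequality for a single block `a` split off from the blocks in `insert a s`. -/
theorem PosDef.det_re_insert_le {κ ι : Type*} [DecidableEq κ] [Fintype κ] [Fintype ι]
    [DecidableEq ι] {M : Matrix (κ × ι) (κ × ι) ℂ} (hM : M.PosDef) {a : κ} {s : Finset κ}
    (ha : a ∉ s) :
    (principalBlock M (insert a s)).det.re ≤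
      (M.submatrix (Prod.mk a) (Prod.mk a)).det.re * (principalBlock M s).det.re := by
  have hM' : (principalBlock M (insert a s)).PosDef := PosDef.principalBlock_posDef hM _
  refine PosDef.det_re_le_mul hM'
    (f := fun i => (⟨a, Finset.mem_insert_self a s⟩, i))
    (g := fun p : s × ι => (⟨p.1.1, Finset.mem_insert_of_mem p.1.2⟩, p.2)) ⟨?_, ?_⟩
  · rintro (i | ⟨⟨x, hx⟩, i⟩) (j | ⟨⟨y, hy⟩, j⟩) h
    · simpa using h
    · simp only [Sum.elim_inl, Sum.elim_inr, Prod.mk.injEq, Subtype.mk.injEq] at h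
      exact absurd (h.1 ▸ hy) ha
    · simp only [Sum.elim_inl, Sum.elim_inr, Prod.mk.injEq, Subtype.mk.injEq] at h
      exact absurd (h.1 ▸ hx) ha
    · simpa using h
  · rintro ⟨⟨x, hx⟩, i⟩
    rcases Finset.mem_insert.mp hx with rfl | h
    · exact ⟨Sum.inl i, rfl⟩
    · exact ⟨Sum.inr (⟨x, h⟩, i), rfl⟩

theorem PosDef.det_re_union_le {κ ι : Type*} [DecidableEq κ] [Fintype κ] [Fintype ι]
    [DecidableEq ι] {M : Matrix (κ × ι) (κ × ι) ℂ} (hM : M.PosDef) (s u : Finset κ)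
    (hsu : Disjoint s u) :
    (principalBlock M (s ∪ u)).det.re ≤
      (principalBlock M s).det.re * ∏ i ∈ u, (M.submatrix (Prod.mk i) (Prod.mk i)).det.re := by
  induction u using Finset.induction_on with
  | empty => rw [Finset.union_empty, Finset.prod_empty, mul_one]
  | insert a u ha ih =>
    rw [Finset.disjoint_insert_right] at hsu
    have h := PosDef.det_re_insert_le hM (a := a) (s := s ∪ u) (by simp [ha, hsu.1])
    rw [Finset.union_insert, Finset.prod_insert ha, mul_left_comm]
    exact h.trans (mul_le_mul_of_nonneg_left (ih hsu.2)
      (PosDef.det_re_pos (hM.submatrix (Prod.mk_right_injective a))).le)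

/-- Fischer's inequality with the blocks `a` and `b` kept together, combined with the two-block
identities for the principal submatrix on these blocks. -/
theorem PosDef.exists_pair_bound {κ ι : Type*} [DecidableEq κ] [Fintype κ] [Fintype ι]
    [DecidableEq ι] {M : Matrix (κ × ι) (κ × ι) ℂ} (hM : M.PosDef) {a b : κ} (hab : a ≠ b) :
    ∃ t : ι → ℝ, 0 ≤ t ∧
      ‖(M.submatrix (Prod.mk a) (Prod.mk b)).det‖ ^ 2 * ∏ i, (1 + t i) =
        (M.submatrix (Prod.mk a) (Prod.mk a)).det.re *
          (M.submatrix (Prod.mk b) (Prod.mk b)).det.re * ∏ i, t i ∧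
      M.det.re * ∏ i, (1 + t i) ≤ ∏ i, (M.submatrix (Prod.mk i) (Prod.mk i)).det.re ∧
      (t = 0 → M.submatrix (Prod.mk a) (Prod.mk b) = 0) := by
  have ha : a ∈ ({a, b} : Finset κ) := by simp
  have hb : b ∈ ({a, b} : Finset κ) := by simp
  obtain ⟨t, ht, h1, h2, h3⟩ := PosDef.exists_two_block (PosDef.principalBlock_posDef hM {a, b})
    (f := fun i : ι => (⟨a, ha⟩, i)) (g := fun i : ι => (⟨b, hb⟩, i)) (by
      constructor
      · rintro (i | i) (j | j) h
        · simpa using h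
        · simp [hab] at h
        · simp [hab.symm] at h
        · simpa using h
      · rintro ⟨⟨x, hx⟩, i⟩
        obtain rfl | rfl : x = a ∨ x = b := by simpa using hx
        · exact ⟨Sum.inl i, rfl⟩
        · exact ⟨Sum.inr i, rfl⟩)
  refine ⟨t, ht, ?_, ?_, h3⟩
  · change (M.submatrix (Prod.mk a) (Prod.mk a)).det.re *
      (M.submatrix (Prod.mk b) (Prod.mk b)).det.re = _ at h1
    change ‖(M.submatrix (Prod.mk a) (Prod.mk b)).det‖ ^ 2 = _ at h2
    rw [h1, h2]
    ring
  · change (M.submatrix (Prod.mk a) (Prod.mk a)).det.re *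
      (M.submatrix (Prod.mk b) (Prod.mk b)).det.re = _ at h1
    have h := PosDef.det_re_union_le hM {a, b} ({a, b}ᶜ) disjoint_compl_right
    rw [Finset.union_compl, det_principalBlock_univ] at h
    have hpos : 0 ≤ ∏ i, (1 + t i) := zero_le_one.trans (one_le_prod_one_add _ ht)
    refine (mul_le_mul_of_nonneg_right h hpos).trans_eq ?_
    rw [← Finset.prod_mul_prod_compl {a, b}, Finset.prod_pair hab, h1]
    ring

/-! ### Relative determinants of off-diagonal blocks -/

/-- The squared modulus of the determinant of the block `(a, b)`, relative to the determinants of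
the diagonal blocks `a` and `b`. -/
noncomputable def relDet {κ ι : Type*} [Fintype ι] [DecidableEq ι]
    (M : Matrix (κ × ι) (κ × ι) ℂ) (a b : κ) : ℝ :=
  ‖(M.submatrix (Prod.mk a) (Prod.mk b)).det‖ ^ 2 /
    ((M.submatrix (Prod.mk a) (Prod.mk a)).det.re * (M.submatrix (Prod.mk b) (Prod.mk b)).det.re)

section relDet

variable {κ ι : Type*} [DecidableEq κ] [Fintype ι] [DecidableEq ι] [Fintype κ]
  {M : Matrix (κ × ι) (κ × ι) ℂ}

omit [DecidableEq κ] [Fintype κ] in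
theorem PosDef.block_pos (hM : M.PosDef) (a : κ) :
    0 < (M.submatrix (Prod.mk a) (Prod.mk a)).det.re :=
  PosDef.det_re_pos (hM.submatrix (Prod.mk_right_injective a))

omit [DecidableEq κ] [Fintype κ] in
theorem relDet_nonneg (hM : M.PosDef) (a b : κ) : 0 ≤ relDet M a b :=
  div_nonneg (sq_nonneg _) (mul_pos (PosDef.block_pos hM a) (PosDef.block_pos hM b)).le

theorem PosDef.exists_relDet_eq (hM : M.PosDef) {a b : κ} (hab : a ≠ b) :
    ∃ t : ι → ℝ, 0 ≤ t ∧ relDet M a b = (∏ i, t i) / ∏ i, (1 + t i) ∧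
      M.det.re * ∏ i, (1 + t i) ≤ ∏ i, (M.submatrix (Prod.mk i) (Prod.mk i)).det.re ∧
      (t = 0 → M.submatrix (Prod.mk a) (Prod.mk b) = 0) := by
  obtain ⟨t, ht, h1, h2, h3⟩ := PosDef.exists_pair_bound hM hab
  refine ⟨t, ht, ?_, h2, h3⟩
  have hpos : 0 < ∏ i, (1 + t i) := zero_lt_one.trans_le (one_le_prod_one_add _ ht)
  rw [relDet, div_eq_div_iff (mul_pos (PosDef.block_pos hM a) (PosDef.block_pos hM b)).ne' hpos.ne',
    h1, mul_comm]

theorem relDet_lt_one [Nonempty ι] (hM : M.PosDef) {a b : κ} (hab : a ≠ b) : relDet M a b < 1 := by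
  obtain ⟨t, ht, h1, -⟩ := PosDef.exists_relDet_eq hM hab
  have hpos : 0 < ∏ i, (1 + t i) := zero_lt_one.trans_le (one_le_prod_one_add _ ht)
  rw [h1, div_lt_one hpos]
  linarith [one_add_prod_le_prod_one_add ht]

theorem PosDef.det_re_le_mul_one_sub_relDet [Nonempty ι] (hM : M.PosDef) {a b : κ} (hab : a ≠ b) :
    M.det.re ≤ (∏ i, (M.submatrix (Prod.mk i) (Prod.mk i)).det.re) * (1 - relDet M a b) := by
  obtain ⟨t, ht, h1, h2, -⟩ := PosDef.exists_relDet_eq hM hab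
  have hpos : 0 < ∏ i, (1 + t i) := zero_lt_one.trans_le (one_le_prod_one_add _ ht)
  have hd := Finset.prod_pos fun i (_ : i ∈ Finset.univ) => PosDef.block_pos hM i
  rw [h1, one_sub_div hpos.ne', ← mul_div_assoc, le_div_iff₀ hpos]
  refine h2.trans (le_mul_of_one_le_right hd.le ?_)
  linarith [one_add_prod_le_prod_one_add ht]

/-- For blocks of size at least two the bound is strict as soon as the block `(a, b)` is
invertible. -/
theorem PosDef.det_re_lt_mul_one_sub_relDet [Nontrivial ι] (hM : M.PosDef) {a b : κ} (hab : a ≠ b)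
    (h0 : 0 < relDet M a b) :
    M.det.re < (∏ i, (M.submatrix (Prod.mk i) (Prod.mk i)).det.re) * (1 - relDet M a b) := by
  obtain ⟨t, ht, h1, h2, -⟩ := PosDef.exists_relDet_eq hM hab
  have hpos : 0 < ∏ i, (1 + t i) := zero_lt_one.trans_le (one_le_prod_one_add _ ht)
  have hd := Finset.prod_pos fun i (_ : i ∈ Finset.univ) => PosDef.block_pos hM i
  have ht' : ∀ i, 0 < t i := fun i => (ht i).lt_of_ne' fun h => by
    rw [h1, Finset.prod_eq_zero (Finset.mem_univ i) h, zero_div] at h0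
    exact h0.false
  rw [h1, one_sub_div hpos.ne', ← mul_div_assoc, lt_div_iff₀ hpos]
  refine h2.trans_lt (lt_mul_of_one_lt_right hd ?_)
  linarith [one_add_prod_lt_prod_one_add ht']

/-- The equality case of Fischer's inequality for partitioned matrices. -/
theorem PosDef.block_eq_zero_of_det_re_eq (hM : M.PosDef)
    (h : M.det.re = ∏ i, (M.submatrix (Prod.mk i) (Prod.mk i)).det.re) {a b : κ} (hab : a ≠ b) :
    M.submatrix (Prod.mk a) (Prod.mk b) = 0 := by
  obtain ⟨t, ht, -, h2, h3⟩ := PosDef.exists_relDet_eq hM hab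
  refine h3 (eq_zero_of_prod_one_add_eq_one ht (le_antisymm ?_ (one_le_prod_one_add _ ht)))
  rw [← h] at h2
  exact (mul_le_iff_le_one_right (PosDef.det_re_pos hM)).mp h2

omit [DecidableEq κ] in
/-- In the product over a permutation every diagonal block occurs once as a row and once as a
column. -/
theorem prod_relDet (hM : M.PosDef) (τ : Equiv.Perm κ) :
    (∏ i, ‖(M.submatrix (Prod.mk i) (Prod.mk (τ i))).det‖) ^ 2 =
      (∏ i, (M.submatrix (Prod.mk i) (Prod.mk i)).det.re) ^ 2 * ∏ i, relDet M i (τ i) := by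
  have hd := Finset.prod_pos fun i (_ : i ∈ Finset.univ) => PosDef.block_pos hM i
  simp only [relDet]
  rw [Finset.prod_div_distrib, Finset.prod_mul_distrib, Finset.prod_pow,
    Equiv.prod_comp τ fun i => (M.submatrix (Prod.mk i) (Prod.mk i)).det.re]
  field_simp

/-- Two factors of the product over `τ`, the largest relative determinant among them, give the
square of that determinant; the remaining ones are at most `1`. -/
theorem prod_norm_det_le [Nonempty ι] (hM : M.PosDef) {τ : Equiv.Perm κ} (hτ : τ ∈ derangements κ)
    {a : κ} (ha : ∀ i, relDet M i (τ i) ≤ relDet M a (τ a)) :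
    ∏ i, ‖(M.submatrix (Prod.mk i) (Prod.mk (τ i))).det‖ ≤
      (∏ i, (M.submatrix (Prod.mk i) (Prod.mk i)).det.re) * relDet M a (τ a) := by
  have hd := Finset.prod_pos fun i (_ : i ∈ Finset.univ) => PosDef.block_pos hM i
  refine le_of_sq_le_sq ?_ (mul_nonneg hd.le (relDet_nonneg hM _ _))
  rw [prod_relDet hM, mul_pow]
  refine mul_le_mul_of_nonneg_left ?_ (sq_nonneg _)
  exact prod_le_sq_of_forall_le (q := fun i => relDet M i (τ i)) (fun i => relDet_nonneg hM _ _)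
    (fun i => (relDet_lt_one hM (hτ i).symm).le) (hτ a).symm ha

theorem prod_norm_det_lt [Nonempty ι] (hM : M.PosDef) {τ : Equiv.Perm κ} (hτ : τ ∈ derangements κ)
    {a : κ} (ha : ∀ i, relDet M i (τ i) ≤ relDet M a (τ a)) (h0 : 0 < relDet M a (τ a))
    (hκ : 2 < Fintype.card κ) :
    ∏ i, ‖(M.submatrix (Prod.mk i) (Prod.mk (τ i))).det‖ <
      (∏ i, (M.submatrix (Prod.mk i) (Prod.mk i)).det.re) * relDet M a (τ a) := by
  have hd := Finset.prod_pos fun i (_ : i ∈ Finset.univ) => PosDef.block_pos hM i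
  obtain ⟨c, hc⟩ : ∃ c, c ∉ ({a, τ a} : Finset κ) := by
    by_contra! h
    have := Finset.card_le_card (fun x _ => h x : Finset.univ ⊆ ({a, τ a} : Finset κ))
    exact absurd (this.trans Finset.card_le_two) (by simpa using hκ)
  simp only [Finset.mem_insert, Finset.mem_singleton, not_or] at hc
  refine lt_of_pow_lt_pow_left₀ 2 (mul_nonneg hd.le (relDet_nonneg hM _ _)) ?_
  rw [prod_relDet hM, mul_pow]
  refine mul_lt_mul_of_pos_left ?_ (by positivity)
  exact prod_lt_sq_of_forall_le (q := fun i => relDet M i (τ i)) (fun i => relDet_nonneg hM _ _)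
    (fun i => relDet_lt_one hM (hτ i).symm) (hτ a).symm (Ne.symm hc.1) (Ne.symm hc.2) ha h0

/-- The real form of the inequality: both summands are compared at an index `a` where the relative
determinant of the block `(a, τ a)` is largest. -/
theorem PosDef.det_re_add_prod_le [Nonempty ι] [Nonempty κ] (hM : M.PosDef) {τ : Equiv.Perm κ}
    (hτ : τ ∈ derangements κ) :
    M.det.re + ∏ i, ‖(M.submatrix (Prod.mk i) (Prod.mk (τ i))).det‖ ≤
      ∏ i, (M.submatrix (Prod.mk i) (Prod.mk i)).det.re := by
  obtain ⟨a, ha⟩ := Finite.exists_max fun i => relDet M i (τ i)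
  linarith [PosDef.det_re_le_mul_one_sub_relDet hM (hτ a).symm, prod_norm_det_le hM hτ ha]

/-- The equality case, provided that there are at least three blocks or that they have size at least
two. -/
theorem PosDef.block_eq_zero_of_det_re_add_prod_eq [Nonempty ι] [Nonempty κ] (hM : M.PosDef)
    {τ : Equiv.Perm κ} (hτ : τ ∈ derangements κ)
    (hκι : 2 < Fintype.card κ ∨ 1 < Fintype.card ι)
    (h : M.det.re + ∏ i, ‖(M.submatrix (Prod.mk i) (Prod.mk (τ i))).det‖ =
      ∏ i, (M.submatrix (Prod.mk i) (Prod.mk i)).det.re) {a b : κ} (hab : a ≠ b) :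
    M.submatrix (Prod.mk a) (Prod.mk b) = 0 := by
  obtain ⟨c, hc⟩ := Finite.exists_max fun i => relDet M i (τ i)
  have h1 := PosDef.det_re_le_mul_one_sub_relDet hM (hτ c).symm
  have h2 := prod_norm_det_le hM hτ hc
  rcases (relDet_nonneg hM c (τ c)).eq_or_lt with h0 | h0
  · -- all the blocks `(i, τ i)` are singular, so this is equality in Fischer's inequality
    rw [← h0, mul_zero] at h2
    have h3 : 0 ≤ ∏ i, ‖(M.submatrix (Prod.mk i) (Prod.mk (τ i))).det‖ :=
      Finset.prod_nonneg fun _ _ => norm_nonneg _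
    exact PosDef.block_eq_zero_of_det_re_eq hM (by linarith) hab
  · exfalso
    rcases hκι with hκ | hι
    · linarith [prod_norm_det_lt hM hτ hc h0 hκ]
    · have := Fintype.one_lt_card_iff_nontrivial.mp hι
      linarith [PosDef.det_re_lt_mul_one_sub_relDet hM (hτ c).symm h0]

end relDet

/-! ### The inequality for derangements -/

theorem det_comp_of_isDiag {κ ι : Type*} [Fintype κ] [DecidableEq κ] [Fintype ι] [DecidableEq ι]
    {A : Matrix κ κ (Matrix ι ι ℂ)} (hA : A.IsDiag) :
    (Matrix.comp κ κ ι ι ℂ A).det = ∏ i, (A i i).det := by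
  rw [← det_blockDiagonal, ← det_submatrix_equiv_self (Equiv.prodComm κ ι)]
  congr 1
  ext ⟨i, x⟩ ⟨j, y⟩
  by_cases h : i = j
  · subst h
    rw [submatrix_apply]
    exact (blockDiagonal_apply_eq (fun i => A i i) x y i).symm
  · rw [submatrix_apply]
    exact (congrFun₂ (hA h) x y).trans (blockDiagonal_apply_ne _ _ _ h).symm

end Matrix

theorem mainTheorem5 (n k : ℕ) (hn : 0 < n) (hk : 0 < k)
    (A : Matrix (Fin n) (Fin n) (Matrix (Fin k) (Fin k) ℂ))
    (hA : (Matrix.comp (Fin n) (Fin n) (Fin k) (Fin k) ℂ A).PosDef)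
    (τ : Equiv.Perm (Fin n)) (hτ : τ ∈ derangements (Fin n)) :
    (Matrix.comp (Fin n) (Fin n) (Fin k) (Fin k) ℂ A).det
        + ((∏ i, ‖(A i (τ i)).det‖ : ℝ) : ℂ) ≤ ∏ i, (A i i).det ∧
    (¬ (n = 2 ∧ k = 1) →
      ((Matrix.comp (Fin n) (Fin n) (Fin k) (Fin k) ℂ A).det
          + ((∏ i, ‖(A i (τ i)).det‖ : ℝ) : ℂ) = ∏ i, (A i i).det ↔
        A.IsDiag)) := by
  have : Nonempty (Fin n) := ⟨⟨0, hn⟩⟩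
  have : Nonempty (Fin k) := ⟨⟨0, hk⟩⟩
  have hblock (i : Fin n) : (((A i i).det.re : ℝ) : ℂ) = (A i i).det :=
    Matrix.PosDef.ofReal_det_re (hA.submatrix (Prod.mk_right_injective i))
  -- all the determinants involved are real, so both claims are statements about real parts
  have hprod : ∏ i, (A i i).det = ((∏ i, (A i i).det.re : ℝ) : ℂ) := by
    push_cast
    exact Finset.prod_congr rfl fun i _ => (hblock i).symm
  refine ⟨?_, fun hnk => ⟨fun h => ?_, fun h => ?_⟩⟩
  · rw [hprod, ← Matrix.PosDef.ofReal_det_re hA]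
    exact_mod_cast Matrix.PosDef.det_re_add_prod_le hA hτ
  · rw [hprod, ← Matrix.PosDef.ofReal_det_re hA] at h
    refine fun i j hij => Matrix.PosDef.block_eq_zero_of_det_re_add_prod_eq hA hτ ?_
      (by exact_mod_cast h) hij
    -- a single block admits no derangement
    have h2 : n ≠ 1 := by
      rintro rfl
      exact hτ 0 (Subsingleton.elim _ _)
    simp only [Fintype.card_fin]
    omega
  · have h0 : ∏ i, ‖(A i (τ i)).det‖ = 0 :=
      Finset.prod_eq_zero (Finset.mem_univ ⟨0, hn⟩) (by rw [h (hτ _).symm]; simp)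
    rw [h0, Matrix.det_comp_of_isDiag h, Complex.ofReal_zero, add_zero]
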